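/- Let $n,m\ge 1$ be integers. For $z\in\mathbb C^n$ and $\alpha\in\mathbb N^n$ write $z^\alpha=z_1^{\alpha_1}\cdots z_n^{\alpha_n}$ and $|\alpha|=\alpha_1+\cdots+\alpha_n$. Let $f,g_1,\dots,g_m$ be real-valued complex polynomials on $\mathbb C^n$, i.e. finite sums $\varphi(z)=\sum_{\alpha,\beta}\varphi_{\alpha,\beta}\,\bar z^\alpha z^\beta$ with $\varphi_{\alpha,\beta}\in\mathbb C$ that take only real values. Put $g_0:=1$. Let $k$ (resp. $k_i$, $0\le i\le m$) be the least integer $l\ge 0$ such that every coefficient of $f$ (resp. $g_i$) with $|\alpha|>l$ or $|\beta|>l$ vanishes, so $k_0=0$, and let $d_{\min}:=\max\{k,k_1,\dots,k_m\}$. Consider the problem of minimizing $f(z)$ over $z\in\mathbb C^n$ subject to $g_i(z)\ge 0$, $i=1,\dots,m$ (its feasible set may be empty). For $d\ge d_{\min}$ let $\mathcal H_d$ be the set of families $y=(y_{\alpha,\beta})_{|\alpha|,|\beta|\le d}$ of complex numbers with $\overline{y_{\alpha,\beta}}=y_{\beta,\alpha}$. Put $L_y(f):=\sum_{\alpha,\beta}f_{\alpha,\beta}\,y_{\alpha,\beta}\in\mathbb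 R$, and let $M_{d-k_i}(g_iy)$ be the Hermitian matrix indexed by $|\alpha|,|\beta|\le d-k_i$ with entries $\sum_{\gamma,\delta}g_{i,\gamma,\delta}\,y_{\alpha+\gamma,\beta+\delta}$. The complex moment relaxation of order $d$ has value $$\rho_d:=\inf\{\,L_y(f)\;:\;y\in\mathcal H_d,\ y_{0,0}=1,\ M_{d-k_i}(g_iy)\succcurlyeq 0\ \ (i=0,\dots,m)\,\}.$$ Let $\Sigma_e[z]$ be the set of functions $\sum_{j=1}^r|p_j|^2$ with $r\ge 1$ and $p_j\in\mathbb C[z_1,\dots,z_n]$ of total degree at most $e$. The complex sum-of-squares relaxation of order $d$ has value $$\rho_d^*:=\sup\Big\{\,\lambda\in\mathbb R\;:\;f-\lambda=\sum_{i=0}^m\sigma_i g_i\ \text{ on }\mathbb C^n\ \text{ for some }\sigma_i\in\Sigma_{d-k_i}[z]\Big\}.$$ Both values lie in $[-\infty,+\infty]$, with $\inf\emptyset=+\infty$ and $\sup\emptyset=-\infty$. Assume the sphere assumption: for some $R>0$, one of the constraints is the sphere constraint $|z_1|^2+\cdots+|z_n|^2=R^2$, written as two opposite inequality constraints, i.e.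 both $R^2-\sum_k|z_k|^2$ and $\sum_k|z_k|^2-R^2$ occur among $g_1,\dots,g_m$. Then for every $d\ge d_{\min}$ there is no duality gap: $$\rho_d^*=\rho_d\in\mathbb R\cup\{+\infty\}.$$ -/

import Mathlib

open scoped ComplexOrder

noncomputable section

namespace ComplexHierarchy

/-- Multi-indices `α ∈ ℕⁿ`; their length `|α| = α₁ + ⋯ + αₙ` is `Finsupp.degree α`. -/
abbrev MultiIndex (n : ℕ) : Type := Fin n →₀ ℕ

/-- Polynomials `∑ c_{α,β} z̄^α z^β` in `ℂ[z̄, z]`, given by their finitely supported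
coefficients `(α, β) ↦ c_{α,β}`. -/
abbrev ConjPoly (n : ℕ) : Type := (MultiIndex n × MultiIndex n) →₀ ℂ

/-- The monomial function `z^α`. -/
def mono {n : ℕ} (α : MultiIndex n) (z : Fin n → ℂ) : ℂ := ∏ k, z k ^ α k

/-- The function `z ↦ ∑ c_{α,β} z̄^α z^β` on `ℂⁿ`. -/
def evalAt {n : ℕ} (φ : ConjPoly n) (z : Fin n → ℂ) : ℂ :=
  φ.sum fun ab c => c * (starRingEnd ℂ (mono ab.1 z) * mono ab.2 z)

/-- Membership in `ℝ[z̄, z]`: the function `φ` takes real values on `ℂⁿ`. -/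
def IsRealValued {n : ℕ} (φ : ConjPoly n) : Prop :=
  ∀ z : Fin n → ℂ, starRingEnd ℂ (evalAt φ z) = evalAt φ z

/-- The least `l` such that all coefficients `c_{α,β}` with `|α| > l` or `|β| > l` vanish. -/
def order {n : ℕ} (φ : ConjPoly n) : ℕ :=
  φ.support.sup fun ab => max ab.1.degree ab.2.degree

/-- The constant polynomial `1`. -/
def onePoly (n : ℕ) : ConjPoly n := Finsupp.single (0, 0) 1

/-- The family `g₀ = 1, g₁, …, g_m` (with `g₁, …, g_m` given as a family on `Fin m`). -/
def withOne {n m : ℕ} (g : Fin m → ConjPoly n) : Fin (m + 1) → ConjPoly n :=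
  Fin.cons (onePoly n) g

/-- The minimal relaxation order `d_min = max {k, k₁, …, k_m}`. -/
def minOrder {n m : ℕ} (f : ConjPoly n) (g : Fin m → ConjPoly n) : ℕ :=
  max (order f) (Finset.univ.sup fun i => order (g i))

/-- One of the constraints is the sphere constraint `|z₁|² + ⋯ + |zₙ|² = R²` for some `R > 0`,
an equality constraint being a pair of opposite inequality constraints. -/
def SphereAssumption {n m : ℕ} (g : Fin m → ConjPoly n) : Prop :=
  ∃ R : ℝ, 0 < R ∧ ∃ i j : Fin m, ∀ z : Fin n → ℂ,
    evalAt (g i) z = ((R ^ 2 - ∑ k, ‖z k‖ ^ 2 : ℝ) : ℂ) ∧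
    evalAt (g j) z = ((∑ k, ‖z k‖ ^ 2 - R ^ 2 : ℝ) : ℂ)

/-! ### The moment relaxation -/

/-- Multi-indices with `|α| ≤ d`. -/
abbrev BddIndex (n d : ℕ) : Type := {α : MultiIndex n // α.degree ≤ d}

/-- The entry `y_{α,β}` of a truncated family `(y_{α,β})_{|α|,|β| ≤ d}`
(and `0` outside of the index range). -/
def entry {n d : ℕ} (y : Matrix (BddIndex n d) (BddIndex n d) ℂ) (α β : MultiIndex n) : ℂ :=
  if h : α.degree ≤ d ∧ β.degree ≤ d then y ⟨α, h.1⟩ ⟨β, h.2⟩ else 0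

/-- `L_y(φ) = ∑ φ_{α,β} y_{α,β}`. -/
def riesz {n d : ℕ} (y : Matrix (BddIndex n d) (BddIndex n d) ℂ) (φ : ConjPoly n) : ℂ :=
  φ.sum fun ab c => c * entry y ab.1 ab.2

/-- `M_e(φ y)(α, β) = ∑ φ_{γ,δ} y_{α+γ,β+δ}` for `|α|, |β| ≤ e`. -/
def localizing {n d : ℕ} (e : ℕ) (φ : ConjPoly n)
    (y : Matrix (BddIndex n d) (BddIndex n d) ℂ) :
    Matrix (BddIndex n e) (BddIndex n e) ℂ :=
  fun α β => φ.sum fun cd c => c * entry y (α.1 + cd.1) (β.1 + cd.2)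

/-- Feasible points of the moment relaxation of order `d`: Hermitian families `y`
with `y_{0,0} = 1` and `M_{d - k_i}(g_i y) ≽ 0` for `i = 0, …, m`. -/
def momentFeasible {n m : ℕ} (g : Fin m → ConjPoly n) (d : ℕ) :
    Set (Matrix (BddIndex n d) (BddIndex n d) ℂ) :=
  {y | y.IsHermitian ∧ entry y 0 0 = 1 ∧
    ∀ i : Fin (m + 1), (localizing (d - order (withOne g i)) (withOne g i) y).PosSemidef}

/-- The value `ρ_d` of the moment relaxation (an infimum in `[-∞, +∞]`). -/
def momentValue {n m : ℕ} (f : ConjPoly n) (g : Fin m → ConjPoly n) (d : ℕ) : EReal :=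
  ⨅ y ∈ momentFeasible g d, ((riesz y f).re : EReal)

/-! ### The sum-of-squares relaxation -/

/-- `Σ_e[z]`: functions `∑_{j=1}^r |p_j|²` with `r ≥ 1` and `p_j` holomorphic polynomials of
degree at most `e`. -/
def sosCone (n e : ℕ) : Set ((Fin n → ℂ) → ℂ) :=
  {σ | ∃ (r : ℕ) (p : Fin r → MvPolynomial (Fin n) ℂ), 0 < r ∧
    (∀ j, (p j).totalDegree ≤ e) ∧
    ∀ z, σ z = ((∑ j, ‖MvPolynomial.eval z (p j)‖ ^ 2 : ℝ) : ℂ)}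

/-- Feasible values of `λ` in the sum-of-squares relaxation of order `d`:
`f - λ = ∑_{i=0}^m σ_i g_i` for some `σ_i ∈ Σ_{d - k_i}[z]`. -/
def sosFeasible {n m : ℕ} (f : ConjPoly n) (g : Fin m → ConjPoly n) (d : ℕ) : Set ℝ :=
  {l | ∃ σ : Fin (m + 1) → ((Fin n → ℂ) → ℂ),
    (∀ i, σ i ∈ sosCone n (d - order (withOne g i))) ∧
    ∀ z : Fin n → ℂ, evalAt f z - (l : ℂ) = ∑ i, σ i z * evalAt (withOne g i) z}

/-- The value `ρ*_d` of the sum-of-squares relaxation (a supremum in `[-∞, +∞]`). -/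
def sosValue {n m : ℕ} (f : ConjPoly n) (g : Fin m → ConjPoly n) (d : ℕ) : EReal :=
  ⨆ l ∈ sosFeasible f g d, ((l : ℝ) : EReal)

end ComplexHierarchy

end

noncomputable section

namespace ComplexHierarchy

/-! ### Separation from a cone with an order unit -/

/-! Weak duality: a certificate `f - λ = ∑ σ_i g_i` between functions is an identity between
coefficients (`eq_zero_of_evalLin_eq_zero`), so `L_y` may be applied to it, and each `L_y(|p|² g_i)`
is a value of a positive semidefinite form.

Strong duality: `|z|² ≤ R²` among the constraints makes `1` an order unit of the truncated quadratic
module at every order `d` (`exists_const_add_reEval_mem`). M. Riesz extension then separates any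
point outside the cone by a functional already normalised at `1`, so neither closedness of the cone
nor a strictly feasible point is needed. If `λ` has no certificate, separating `f - λ` from the cone
yields a feasible `y` with `L_y(f) ≤ λ`; hence `ρ_d ≤ λ` for all `λ > ρ*_d`. The order unit also
provides some certificate, so the common value is not `-∞`. -/

/-- A point outside of a convex cone with order unit `e` is separated from the cone by a linear
functional normalised at `e`. -/
theorem exists_functional_of_notMem {E : Type*} [AddCommGroup E] [Module ℝ E]
    (C : PointedCone ℝ E) {e p : E} (he : e ∈ C) (hunit : ∀ x : E, ∃ N : ℝ, N • e + x ∈ C)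
    (hp : p ∉ C) :
    ∃ L : E →ₗ[ℝ] ℝ, L e = 1 ∧ (∀ x ∈ C, 0 ≤ L x) ∧ L p ≤ 0 := by
  have smulC : ∀ {c : ℝ} {x : E}, 0 ≤ c → x ∈ C → c • x ∈ C := fun hc hx =>
    C.smul_mem hc hx
  -- With `-e` in `C`, the order unit property would put every point, including `p`, into `C`.
  have hneg : -e ∉ C := by
    intro hne
    obtain ⟨N, hN⟩ := hunit p
    apply hp
    rcases le_total 0 N with h | h
    · have := C.add_mem hN (smulC h hne)
      simpa using this
    · have := C.add_mem hN (smulC (neg_nonneg.2 h) he)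
      simpa using this
  have he0 : e ≠ 0 := by
    rintro rfl
    exact hneg (by simp)
  -- Adjoining the ray through `-p` forces `L p ≤ 0`. The functional `c • e ↦ c` is nonnegative on
  -- `K ∩ ℝe` (`key`), and the order unit gives the domination that Riesz extension requires.
  let K : PointedCone ℝ E := C ⊔ Submodule.span _ {-p}
  have hCK : ∀ x ∈ C, x ∈ K := fun x hx => Submodule.mem_sup_left hx
  have key : ∀ c : ℝ, c • e ∈ K → 0 ≤ c := by
    intro c hc
    obtain ⟨a, ha, b, hb, hab⟩ := Submodule.mem_sup.1 hc
    obtain ⟨t, rfl⟩ := Submodule.mem_span_singleton.1 hb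
    obtain ⟨t, ht⟩ := t
    change a + t • (-p) = c • e at hab
    by_contra! hlt
    rcases ht.eq_or_lt with rfl | ht
    · rw [zero_smul, add_zero] at hab
      apply hneg
      have := smulC (c := -c⁻¹) (by simpa using hlt.le) ha
      rw [hab, smul_smul] at this
      simpa [hlt.ne] using this
    · apply hp
      have h1 := smulC (c := t⁻¹) (by positivity)
        (C.add_mem ha (smulC (c := -c) (by linarith) he))
      have h2 : a + -c • e = t • p := by
        rw [neg_smul, ← hab]; module
      rw [h2, smul_smul, inv_mul_cancel₀ ht.ne', one_smul] at h1
      exact h1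
  obtain ⟨L, hL, hLK⟩ := riesz_extension K
    (LinearPMap.mkSpanSingleton e (1 : ℝ) he0 : E →ₗ.[ℝ] ℝ) (by
      rintro ⟨x, hx⟩ hxK
      obtain ⟨c, rfl⟩ := Submodule.mem_span_singleton.1 hx
      rw [LinearPMap.mkSpanSingleton'_apply]
      simpa using key c hxK) (by
      intro x
      obtain ⟨N, hN⟩ := hunit x
      exact ⟨⟨N • e, Submodule.smul_mem _ _ (Submodule.mem_span_singleton_self e)⟩, hCK _ hN⟩)
  refine ⟨L, ?_, fun x hx => hLK x (hCK x hx), ?_⟩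
  · have := hL ⟨e, Submodule.mem_span_singleton_self e⟩
    rw [this]
    exact LinearPMap.mkSpanSingleton_apply ℝ ℝ he0 1
  · have := hLK (-p) (Submodule.mem_sup_right (Submodule.mem_span_singleton_self _))
    simpa using this

variable {n m : ℕ}

/-! ### Linear functionals on `ℂ[z̄, z]` -/

/-- Evaluation at `z` as a linear map. -/
def evalLin (z : Fin n → ℂ) : ConjPoly n →ₗ[ℂ] ℂ :=
  Finsupp.linearCombination ℂ fun ab => starRingEnd ℂ (mono ab.1 z) * mono ab.2 z

theorem evalLin_apply (z : Fin n → ℂ) (φ : ConjPoly n) : evalLin z φ = evalAt φ z := rfl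

/-- The Riesz functional as a linear map. -/
def rieszLin {d : ℕ} (y : Matrix (BddIndex n d) (BddIndex n d) ℂ) : ConjPoly n →ₗ[ℂ] ℂ :=
  Finsupp.linearCombination ℂ fun ab => entry y ab.1 ab.2

theorem rieszLin_apply {d : ℕ} (y : Matrix (BddIndex n d) (BddIndex n d) ℂ) (φ : ConjPoly n) :
    rieszLin y φ = riesz y φ := rfl

theorem mono_add (α β : MultiIndex n) (z : Fin n → ℂ) : mono (α + β) z = mono α z * mono β z := by
  simp [mono, pow_add, Finset.prod_mul_distrib]

theorem mono_zero (z : Fin n → ℂ) : mono 0 z = 1 := by simp [mono]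

theorem mono_single (k : Fin n) (z : Fin n → ℂ) : mono (Finsupp.single k 1) z = z k := by
  classical
  rw [mono, Finset.prod_eq_single k] <;> simp +contextual [eq_comm]

theorem evalLin_single (α β : MultiIndex n) (c : ℂ) (z : Fin n → ℂ) :
    evalLin z (Finsupp.single (α, β) c) = c * (starRingEnd ℂ (mono α z) * mono β z) := by
  simp [evalLin]

/-- The polynomial `z̄^α z^β φ`. -/
def shift (α β : MultiIndex n) (φ : ConjPoly n) : ConjPoly n :=
  Finsupp.mapDomain (fun cd => (α + cd.1, β + cd.2)) φ

theorem linearCombination_shift (α β : MultiIndex n) (φ : ConjPoly n)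
    (v : MultiIndex n × MultiIndex n → ℂ) :
    Finsupp.linearCombination ℂ v (shift α β φ) =
      φ.sum fun cd c => c * v (α + cd.1, β + cd.2) := by
  rw [shift, Finsupp.linearCombination_mapDomain]
  rfl

theorem rieszLin_shift {d e : ℕ} (y : Matrix (BddIndex n d) (BddIndex n d) ℂ)
    (α β : BddIndex n e) (φ : ConjPoly n) :
    rieszLin y (shift α.1 β.1 φ) = localizing e φ y α β :=
  linearCombination_shift _ _ _ _

theorem evalLin_shift (α β : MultiIndex n) (φ : ConjPoly n) (z : Fin n → ℂ) :
    evalLin z (shift α β φ) = starRingEnd ℂ (mono α z) * mono β z * evalAt φ z := by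
  rw [evalLin, linearCombination_shift, evalAt, Finsupp.mul_sum]
  refine Finsupp.sum_congr fun cd _ => ?_
  simp only [mono_add, map_mul]
  ring

/-- The holomorphic polynomial with coefficients `x`. -/
def holo {e : ℕ} (x : BddIndex n e →₀ ℂ) (z : Fin n → ℂ) : ℂ := x.sum fun β c => c * mono β.1 z

/-- The polynomial `|p|² φ`, where `p` has coefficients `x`. -/
def gram {e : ℕ} (x : BddIndex n e →₀ ℂ) (φ : ConjPoly n) : ConjPoly n :=
  x.sum fun α a => x.sum fun β b => (starRingEnd ℂ a * b) • shift α.1 β.1 φ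

theorem map_gram {e : ℕ} (Λ : ConjPoly n →ₗ[ℂ] ℂ) (x : BddIndex n e →₀ ℂ) (φ : ConjPoly n) :
    Λ (gram x φ) =
      x.sum fun α a => x.sum fun β b => starRingEnd ℂ a * Λ (shift α.1 β.1 φ) * b := by
  simp only [gram, Finsupp.sum, map_sum, map_smul, smul_eq_mul]
  refine Finset.sum_congr rfl fun α _ => Finset.sum_congr rfl fun β _ => ?_
  ring

theorem rieszLin_gram {d e : ℕ} (y : Matrix (BddIndex n d) (BddIndex n d) ℂ)
    (x : BddIndex n e →₀ ℂ) (φ : ConjPoly n) :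
    rieszLin y (gram x φ) =
      x.sum fun α a => x.sum fun β b => star a * localizing e φ y α β * b := by
  simp only [map_gram, rieszLin_shift, starRingEnd_apply]

theorem sum_sum_eq_normSq_mul {e : ℕ} (x : BddIndex n e →₀ ℂ) (z : Fin n → ℂ) (w : ℂ) :
    (x.sum fun α a => x.sum fun β b =>
      starRingEnd ℂ a * (starRingEnd ℂ (mono α.1 z) * mono β.1 z * w) * b) =
      ((‖holo x z‖ ^ 2 : ℝ) : ℂ) * w := by
  have h : ((‖holo x z‖ ^ 2 : ℝ) : ℂ) = starRingEnd ℂ (holo x z) * holo x z := by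
    rw [Complex.conj_mul']; push_cast; rfl
  rw [h, holo]
  simp only [Finsupp.sum, map_sum, map_mul, Finset.sum_mul, Finset.mul_sum]
  rw [Finset.sum_comm]
  refine Finset.sum_congr rfl fun α _ => Finset.sum_congr rfl fun β _ => ?_
  ring

theorem evalLin_gram {e : ℕ} (x : BddIndex n e →₀ ℂ) (φ : ConjPoly n) (z : Fin n → ℂ) :
    evalLin z (gram x φ) = ((‖holo x z‖ ^ 2 : ℝ) : ℂ) * evalAt φ z := by
  simp only [map_gram, evalLin_shift, sum_sum_eq_normSq_mul]

theorem eval_monomial_eq_mono (α : MultiIndex n) (c : ℂ) (z : Fin n → ℂ) :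
    MvPolynomial.eval z (MvPolynomial.monomial α c) = c * mono α z := by
  rw [MvPolynomial.eval_monomial, mono, Finsupp.prod_fintype _ _ (by simp)]

theorem totalDegree_monomial_le_degree (α : MultiIndex n) (c : ℂ) :
    (MvPolynomial.monomial α c).totalDegree ≤ α.degree :=
  MvPolynomial.totalDegree_monomial_le α c

theorem exists_poly_eq_holo {e : ℕ} (x : BddIndex n e →₀ ℂ) :
    ∃ p : MvPolynomial (Fin n) ℂ, p.totalDegree ≤ e ∧ ∀ z, MvPolynomial.eval z p = holo x z := by
  refine ⟨∑ β ∈ x.support, MvPolynomial.monomial β.1 (x β),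
    MvPolynomial.totalDegree_finsetSum_le fun β _ =>
      (totalDegree_monomial_le_degree _ _).trans β.2, fun z => ?_⟩
  simp only [map_sum, eval_monomial_eq_mono]
  rfl

theorem exists_holo_eq_poly {e : ℕ} (p : MvPolynomial (Fin n) ℂ) (hp : p.totalDegree ≤ e) :
    ∃ x : BddIndex n e →₀ ℂ, ∀ z, MvPolynomial.eval z p = holo x z := by
  have hdeg : ∀ β ∈ p.support, Finsupp.degree β ≤ e := fun β hβ =>
    le_trans (MvPolynomial.le_totalDegree hβ) hp
  refine ⟨∑ β ∈ p.support.attach, Finsupp.single ⟨β.1, hdeg _ β.2⟩ (p.coeff β.1), fun z => ?_⟩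
  have h : ∀ x : BddIndex n e →₀ ℂ, holo x z =
      Finsupp.linearCombination ℂ (fun β : BddIndex n e => mono β.1 z) x := fun x => rfl
  rw [h, map_sum, MvPolynomial.eval_eq', ← Finset.sum_attach]
  simp [mono]

/-! ### Coefficients are determined by values -/

/-- Polarisation: replace `z̄, z` by independent variables `u, v`. After `u = x - iy`, `v = x + iy`
the polynomial vanishes for all real `x, y`, hence identically, and this linear substitution is
invertible. -/
theorem eq_zero_of_evalLin_eq_zero {φ : ConjPoly n} (h : ∀ z, evalLin z φ = 0) : φ = 0 := by
  classical
  let e := (Finsupp.sumFinsuppEquivProdFinsupp : (Fin n ⊕ Fin n →₀ ℕ) ≃ _)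
  let P : MvPolynomial (Fin n ⊕ Fin n) ℂ :=
    ∑ ab ∈ φ.support, MvPolynomial.monomial (e.symm ab) (φ ab)
  have hP : ∀ u v : Fin n → ℂ, MvPolynomial.eval (Sum.elim u v) P =
      ∑ ab ∈ φ.support, φ ab * (mono ab.1 u * mono ab.2 v) := by
    intro u v
    simp only [P, map_sum]
    refine Finset.sum_congr rfl fun ab _ => ?_
    rw [MvPolynomial.eval_monomial, Finsupp.prod_fintype _ _ (by simp), Fintype.prod_sum_type]
    simp [mono, e]
  let W : Fin n ⊕ Fin n → MvPolynomial (Fin n ⊕ Fin n) ℂ :=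
    Sum.elim (fun k => MvPolynomial.X (Sum.inl k) - MvPolynomial.C Complex.I *
        MvPolynomial.X (Sum.inr k))
      (fun k => MvPolynomial.X (Sum.inl k) + MvPolynomial.C Complex.I * MvPolynomial.X (Sum.inr k))
  have hW : ∀ s : Fin n ⊕ Fin n → ℂ, MvPolynomial.eval s (MvPolynomial.bind₁ W P) =
      MvPolynomial.eval (Sum.elim (fun k => s (Sum.inl k) - Complex.I * s (Sum.inr k))
        (fun k => s (Sum.inl k) + Complex.I * s (Sum.inr k))) P := by
    intro s
    rw [← MvPolynomial.coe_aeval_eq_eval, RingHom.coe_coe, MvPolynomial.aeval_bind₁]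
    rw [← MvPolynomial.coe_aeval_eq_eval, RingHom.coe_coe]
    congr 2
    ext k
    rcases k with k | k <;> simp [W]
  have hQ : MvPolynomial.bind₁ W P = 0 := by
    refine MvPolynomial.funext_set (fun _ => Set.range ((↑) : ℝ → ℂ))
      (fun _ => Set.infinite_range_of_injective Complex.ofReal_injective) fun s hs => ?_
    have hs' : ∀ k, starRingEnd ℂ (s k) = s k := by
      intro k
      obtain ⟨r, hr⟩ := hs k trivial
      rw [← hr, Complex.conj_ofReal]
    rw [hW, hP, map_zero, ← h fun k => s (Sum.inl k) + Complex.I * s (Sum.inr k)]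
    refine Finset.sum_congr rfl fun ab _ => ?_
    simp [mono, hs', sub_eq_add_neg]
  have hP0 : P = 0 := by
    refine MvPolynomial.funext fun s => ?_
    -- Inverse substitution: `x = (u + v)/2`, `y = i(u - v)/2`.
    have := hW (Sum.elim (fun k => (s (Sum.inl k) + s (Sum.inr k)) / 2)
      (fun k => Complex.I * (s (Sum.inl k) - s (Sum.inr k)) / 2))
    rw [hQ, map_zero] at this
    rw [map_zero, this]
    congr 2
    ext k
    rcases k with k | k <;> simp only [Sum.elim_inl, Sum.elim_inr]
    · linear_combination (s (Sum.inl k) - s (Sum.inr k)) / 2 * Complex.I_sq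
    · linear_combination (s (Sum.inr k) - s (Sum.inl k)) / 2 * Complex.I_sq
  ext ab
  have hc := congrArg (MvPolynomial.coeff (e.symm ab)) hP0
  simp only [P, MvPolynomial.coeff_sum, MvPolynomial.coeff_monomial, MvPolynomial.coeff_zero,
    EmbeddingLike.apply_eq_iff_eq] at hc
  by_contra hne
  rw [Finset.sum_ite_eq', if_pos (Finsupp.mem_support_iff.2 hne)] at hc
  exact hne hc

theorem eq_of_evalLin_eq {φ ψ : ConjPoly n} (h : ∀ z, evalLin z φ = evalLin z ψ) : φ = ψ :=
  sub_eq_zero.1 (eq_zero_of_evalLin_eq_zero fun z => by rw [map_sub, h z, sub_self])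

/-- A real-valued polynomial has Hermitian coefficients. -/
theorem IsRealValued.apply_swap {φ : ConjPoly n} (h : IsRealValued φ) (α β : MultiIndex n) :
    φ (β, α) = starRingEnd ℂ (φ (α, β)) := by
  -- `ψ` represents the complex conjugate of the function `φ`.
  let ψ : ConjPoly n := (Finsupp.mapRange (starRingEnd ℂ) (map_zero _) φ).mapDomain Prod.swap
  have hψ : ψ = φ := by
    refine eq_of_evalLin_eq fun z => ?_
    rw [evalLin_apply z φ, ← h z, evalLin, Finsupp.linearCombination_mapDomain,
      Finsupp.linearCombination_apply, Finsupp.sum_mapRange_index (by simp), evalAt, Finsupp.sum,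
      Finsupp.sum, map_sum]
    refine Finset.sum_congr rfl fun ab _ => ?_
    simp [mul_comm]
  rw [← hψ]
  change ψ (Prod.swap (α, β)) = _
  rw [Finsupp.mapDomain_apply Prod.swap_injective, Finsupp.mapRange_apply, hψ]

/-! ### The truncated quadratic module -/

theorem normSq_mem_sosCone {e : ℕ} {p : MvPolynomial (Fin n) ℂ} (hp : p.totalDegree ≤ e) :
    (fun z => ((‖MvPolynomial.eval z p‖ ^ 2 : ℝ) : ℂ)) ∈ sosCone n e :=
  ⟨1, fun _ => p, one_pos, fun _ => hp, fun z => by simp⟩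

theorem zero_mem_sosCone (e : ℕ) : (0 : (Fin n → ℂ) → ℂ) ∈ sosCone n e :=
  ⟨1, fun _ => 0, one_pos, fun _ => by simp, fun z => by simp⟩

theorem add_mem_sosCone {e : ℕ} {σ τ : (Fin n → ℂ) → ℂ} (hσ : σ ∈ sosCone n e)
    (hτ : τ ∈ sosCone n e) : σ + τ ∈ sosCone n e := by
  obtain ⟨r, p, hr, hp, hσ⟩ := hσ
  obtain ⟨s, q, hs, hq, hτ⟩ := hτ
  refine ⟨r + s, Fin.append p q, by omega, fun j => ?_, fun z => ?_⟩
  · refine Fin.addCases (fun j => ?_) (fun j => ?_) j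
    · simpa using hp j
    · simpa using hq j
  · simp [hσ, hτ, Fin.sum_univ_add]

theorem smul_mem_sosCone {e : ℕ} {σ : (Fin n → ℂ) → ℂ} {c : ℝ} (hc : 0 ≤ c)
    (hσ : σ ∈ sosCone n e) : c • σ ∈ sosCone n e := by
  obtain ⟨r, p, hr, hp, hσ⟩ := hσ
  refine ⟨r, fun j => ((√c : ℝ) : ℂ) • p j, hr,
    fun j => (MvPolynomial.totalDegree_smul_le _ _).trans (hp j), fun z => ?_⟩
  simp only [Pi.smul_apply, hσ z, MvPolynomial.smul_eval, norm_mul, mul_pow, Complex.norm_real,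
    Real.norm_eq_abs, sq_abs, Real.sq_sqrt hc, ← Finset.mul_sum]
  simp

/-- The functions `∑ σ_i g_i` with `σ_i ∈ Σ_{d - k_i}[z]`. -/
def truncModule (g : Fin m → ConjPoly n) (d : ℕ) : PointedCone ℝ ((Fin n → ℂ) → ℂ) where
  carrier := {h | ∃ σ : Fin (m + 1) → ((Fin n → ℂ) → ℂ),
    (∀ i, σ i ∈ sosCone n (d - order (withOne g i))) ∧
    ∀ z : Fin n → ℂ, h z = ∑ i, σ i z * evalAt (withOne g i) z}
  zero_mem' := ⟨0, fun _ => zero_mem_sosCone _, fun z => by simp⟩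
  add_mem' := by
    rintro h k ⟨σ, hσ, hh⟩ ⟨τ, hτ, hk⟩
    exact ⟨σ + τ, fun i => add_mem_sosCone (hσ i) (hτ i), fun z => by
      simp [hh, hk, add_mul, Finset.sum_add_distrib]⟩
  smul_mem' := by
    rintro ⟨c, hc⟩ h ⟨σ, hσ, hh⟩
    refine ⟨c • σ, fun i => smul_mem_sosCone hc (hσ i), fun z => ?_⟩
    change (c : ℝ) • h z = ∑ i, c • σ i z * _
    simp [hh, Finset.mul_sum, mul_assoc]

theorem mem_truncModule {g : Fin m → ConjPoly n} {d : ℕ} {h : (Fin n → ℂ) → ℂ} :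
    h ∈ truncModule g d ↔ ∃ σ : Fin (m + 1) → ((Fin n → ℂ) → ℂ),
      (∀ i, σ i ∈ sosCone n (d - order (withOne g i))) ∧
      ∀ z : Fin n → ℂ, h z = ∑ i, σ i z * evalAt (withOne g i) z := Iff.rfl

theorem evalAt_onePoly (z : Fin n → ℂ) : evalAt (onePoly n) z = 1 := by
  rw [← evalLin_apply, onePoly, evalLin_single]
  simp [mono_zero]

theorem order_onePoly : order (onePoly n) = 0 := by
  classical
  refine Nat.le_zero.1 (Finset.sup_le fun ab hab => ?_)
  rw [Finset.mem_singleton.1 (Finsupp.support_single_subset hab)]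
  simp

theorem normSq_mul_mem_truncModule (g : Fin m → ConjPoly n) {d : ℕ} (i : Fin (m + 1))
    {p : MvPolynomial (Fin n) ℂ} (hp : p.totalDegree ≤ d - order (withOne g i)) :
    (fun z => ((‖MvPolynomial.eval z p‖ ^ 2 : ℝ) : ℂ) * evalAt (withOne g i) z) ∈
      truncModule g d := by
  refine ⟨fun j => if j = i then fun z => ((‖MvPolynomial.eval z p‖ ^ 2 : ℝ) : ℂ) else 0,
    fun j => ?_, fun z => ?_⟩
  · by_cases h : j = i
    · subst h
      simpa using normSq_mem_sosCone hp
    · simpa [h] using zero_mem_sosCone _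
  · rw [Finset.sum_eq_single i] <;> simp +contextual

theorem normSq_mem_truncModule (g : Fin m → ConjPoly n) {d : ℕ}
    {p : MvPolynomial (Fin n) ℂ} (hp : p.totalDegree ≤ d) :
    (fun z => ((‖MvPolynomial.eval z p‖ ^ 2 : ℝ) : ℂ)) ∈ truncModule g d := by
  have := normSq_mul_mem_truncModule g (d := d) 0 (p := p) (by simpa [withOne, order_onePoly])
  simpa [withOne, evalAt_onePoly] using this

theorem normSq_mono_mem_truncModule (g : Fin m → ConjPoly n) {d : ℕ} {α : MultiIndex n}
    (hα : α.degree ≤ d) : (fun z => ((‖mono α z‖ ^ 2 : ℝ) : ℂ)) ∈ truncModule g d := by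
  have := normSq_mem_truncModule g (p := MvPolynomial.monomial α 1)
    ((totalDegree_monomial_le_degree α 1).trans hα)
  simpa [eval_monomial_eq_mono] using this

theorem const_mem_truncModule (g : Fin m → ConjPoly n) (d : ℕ) {c : ℝ} (hc : 0 ≤ c) :
    (fun _ => (c : ℂ)) ∈ truncModule g d := by
  have := (truncModule g d).smul_mem hc
    (normSq_mono_mem_truncModule g (d := d) (α := 0) (by simp))
  convert this using 1
  ext z
  simp [mono_zero]

/-! ### The constant `1` is an order unit -/

/-- The values determine the coefficients. The bound lets the sphere constraint take multipliers of
degree `d - 1`. -/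
theorem order_le_one_of_sphere {φ : ConjPoly n} {R : ℝ}
    (h : ∀ z : Fin n → ℂ, evalAt φ z = ((R ^ 2 - ∑ k, ‖z k‖ ^ 2 : ℝ) : ℂ)) : order φ ≤ 1 := by
  classical
  let ψ : ConjPoly n := Finsupp.single (0, 0) ((R ^ 2 : ℝ) : ℂ) -
    ∑ k, Finsupp.single (Finsupp.single k 1, Finsupp.single k 1) 1
  have hφ : φ = ψ := by
    refine eq_of_evalLin_eq fun z => ?_
    rw [evalLin_apply, h, map_sub, map_sum, evalLin_single]
    simp [evalLin_single, mono_zero, mono_single, Complex.conj_mul']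
  rw [hφ]
  refine Finset.sup_le fun ab hab => ?_
  by_contra hlt
  refine Finsupp.mem_support_iff.1 hab ?_
  have h0 : ((0, 0) : MultiIndex n × MultiIndex n) ≠ ab := by
    rintro rfl
    simp at hlt
  have h1 : ∀ k, ((Finsupp.single k 1, Finsupp.single k 1) : MultiIndex n × MultiIndex n) ≠ ab := by
    rintro k rfl
    simp at hlt
  simp [ψ, h0, h1]

/-- Induction on the degree by `R²N - |z^β z_k|² = R²(N - |z^β|²) + ∑_{l≠k} |z^β z_l|² + |z^β|²(R² -
∑_l |z_l|²)`, where `|β| ≤ d - 1`. -/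
theorem exists_const_sub_normSq_mono_mem {g : Fin m → ConjPoly n} {d : ℕ} {R : ℝ} {i : Fin m}
    (hi : ∀ z : Fin n → ℂ, evalAt (g i) z = ((R ^ 2 - ∑ k, ‖z k‖ ^ 2 : ℝ) : ℂ))
    (α : MultiIndex n) (hα : α.degree ≤ d) :
    ∃ N : ℝ, (fun z => ((N - ‖mono α z‖ ^ 2 : ℝ) : ℂ)) ∈ truncModule g d := by
  classical
  induction hs : α.degree generalizing α with
  | zero =>
    obtain rfl := (Finsupp.degree_eq_zero_iff α).1 hs
    refine ⟨1, ?_⟩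
    convert (truncModule g d).zero_mem using 1
    ext z
    simp [mono_zero]
  | succ s ih =>
    obtain ⟨k, hk⟩ : ∃ k, α k ≠ 0 := by
      by_contra! h
      rw [show α = 0 from Finsupp.ext h] at hs
      simp at hs
    obtain ⟨β, rfl⟩ : ∃ β, α = β + Finsupp.single k 1 :=
      ⟨α - Finsupp.single k 1, (tsub_add_cancel_of_le (by simpa [Nat.one_le_iff_ne_zero])).symm⟩
    have hβ : β.degree = s := by simpa using hs
    obtain ⟨N, hN⟩ := ih β (by omega) hβ
    refine ⟨R ^ 2 * N, ?_⟩
    have h1 := (truncModule g d).smul_mem (sq_nonneg R) hN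
    have h2 := (truncModule g d).sum_mem (t := Finset.univ.erase k) fun l _ =>
      normSq_mono_mem_truncModule g (d := d) (α := β + Finsupp.single l 1)
        (by simp [hβ]; omega)
    have hord : order (withOne g i.succ) ≤ 1 := by
      simpa [withOne] using order_le_one_of_sphere hi
    have h3 := normSq_mul_mem_truncModule g (d := d) i.succ (p := MvPolynomial.monomial β 1)
      ((totalDegree_monomial_le_degree β 1).trans (by omega))
    convert (truncModule g d).add_mem (add_mem h1 h2) h3 using 1
    ext z
    simp only [Pi.add_apply, Pi.smul_apply, Finset.sum_apply, eval_monomial_eq_mono, one_mul,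
      withOne, Fin.cons_succ, hi, mono_add, mono_single, Complex.real_smul]
    rw [← Finset.add_sum_erase _ _ (Finset.mem_univ k)]
    simp only [norm_mul, mul_pow]
    push_cast
    rw [← Finset.mul_sum]
    ring

/-- Evaluation at `z` after discarding the terms whose indices exceed `d`. -/
def truncEval (d : ℕ) (z : Fin n → ℂ) : ConjPoly n →ₗ[ℂ] ℂ :=
  Finsupp.linearCombination ℂ fun ab =>
    if ab.1.degree ≤ d ∧ ab.2.degree ≤ d then starRingEnd ℂ (mono ab.1 z) * mono ab.2 z else 0

theorem truncEval_single (d : ℕ) (z : Fin n → ℂ) (α β : MultiIndex n) (c : ℂ) :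
    truncEval d z (Finsupp.single (α, β) c) = c *
      if α.degree ≤ d ∧ β.degree ≤ d then starRingEnd ℂ (mono α z) * mono β z else 0 := by
  rw [truncEval, Finsupp.linearCombination_single]
  rfl

theorem degree_le_order {φ : ConjPoly n} {ab : MultiIndex n × MultiIndex n}
    (h : ab ∈ φ.support) : ab.1.degree ≤ order φ ∧ ab.2.degree ≤ order φ :=
  max_le_iff.1 (Finset.le_sup (f := fun ab : MultiIndex n × MultiIndex n =>
    max ab.1.degree ab.2.degree) h)

theorem truncEval_shift {d : ℕ} {α β : MultiIndex n} {φ : ConjPoly n}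
    (hα : α.degree + order φ ≤ d) (hβ : β.degree + order φ ≤ d) (z : Fin n → ℂ) :
    truncEval d z (shift α β φ) = starRingEnd ℂ (mono α z) * mono β z * evalAt φ z := by
  rw [← evalLin_shift, evalLin, truncEval, linearCombination_shift, linearCombination_shift]
  refine Finsupp.sum_congr fun cd hcd => ?_
  have := degree_le_order hcd
  rw [if_pos]
  simp only [map_add]
  omega

theorem truncEval_eq_evalAt {d : ℕ} {φ : ConjPoly n} (h : order φ ≤ d) (z : Fin n → ℂ) :
    truncEval d z φ = evalAt φ z := by
  rw [← evalLin_apply, evalLin, truncEval, Finsupp.linearCombination_apply,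
    Finsupp.linearCombination_apply]
  refine Finsupp.sum_congr fun cd hcd => ?_
  have := degree_le_order hcd
  rw [if_pos (by omega)]

theorem truncEval_gram {d e : ℕ} (x : BddIndex n e →₀ ℂ) {φ : ConjPoly n} (h : e + order φ ≤ d)
    (z : Fin n → ℂ) :
    truncEval d z (gram x φ) = ((‖holo x z‖ ^ 2 : ℝ) : ℂ) * evalAt φ z := by
  rw [map_gram, ← sum_sum_eq_normSq_mul]
  refine Finsupp.sum_congr fun α _ => Finsupp.sum_congr fun β _ => ?_
  have hα := α.2
  have hβ := β.2
  rw [truncEval_shift (by omega) (by omega)]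

/-- The function `z ↦ Re φ(z)`, after discarding the terms of `φ` whose indices exceed `d`. -/
def reEval (n d : ℕ) : ConjPoly n →ₗ[ℝ] ((Fin n → ℂ) → ℂ) :=
  LinearMap.pi fun z =>
    Complex.ofRealCLM.toLinearMap ∘ₗ Complex.reLm ∘ₗ (truncEval d z).restrictScalars ℝ

theorem reEval_apply (d : ℕ) (φ : ConjPoly n) (z : Fin n → ℂ) :
    reEval n d φ z = ((truncEval d z φ).re : ℂ) := rfl

theorem reEval_one (d : ℕ) : reEval n d (onePoly n) = 1 := by
  ext z
  rw [reEval_apply, truncEval_eq_evalAt (by simp [order_onePoly]), evalAt_onePoly]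
  simp

/-- By linearity a single term suffices: `Re(c z̄^α z^β)` equals `½|z^α + c z^β|² - ½|z^α|² -
½|c|²|z^β|²`, and the subtracted squares are bounded by constants modulo the cone. Terms of index
beyond `d` are sent to `0`, so the order unit property holds on all of `ConjPoly n`. -/
theorem exists_const_add_reEval_mem {g : Fin m → ConjPoly n} (hg : SphereAssumption g) (d : ℕ)
    (φ : ConjPoly n) : ∃ N : ℝ, N • onePoly n + φ ∈ (truncModule g d).comap (reEval n d) := by
  obtain ⟨R, -, i, j, hij⟩ := hg
  suffices ∃ N : ℝ, (fun _ => (N : ℂ)) + reEval n d φ ∈ truncModule g d by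
    obtain ⟨N, hN⟩ := this
    refine ⟨N, ?_⟩
    rw [PointedCone.mem_comap, map_add, map_smul, reEval_one]
    convert hN using 2
    ext z
    simp
  induction φ using Finsupp.induction_linear with
  | zero => exact ⟨0, by convert (truncModule g d).zero_mem using 1; ext z; simp⟩
  | add φ ψ hφ hψ =>
    obtain ⟨N, hN⟩ := hφ
    obtain ⟨M, hM⟩ := hψ
    refine ⟨N + M, ?_⟩
    convert (truncModule g d).add_mem hN hM using 1
    ext z
    simp
    ring
  | single ab c =>
    obtain ⟨α, β⟩ := ab
    by_cases h : α.degree ≤ d ∧ β.degree ≤ d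
    · obtain ⟨N, hN⟩ := exists_const_sub_normSq_mono_mem (fun z => (hij z).1) α h.1
      obtain ⟨M, hM⟩ := exists_const_sub_normSq_mono_mem (fun z => (hij z).1) β h.2
      refine ⟨N / 2 + ‖c‖ ^ 2 * M / 2, ?_⟩
      have h1 := (truncModule g d).smul_mem (one_half_pos (α := ℝ)).le hN
      have h2 := (truncModule g d).smul_mem (show 0 ≤ ‖c‖ ^ 2 / 2 by positivity) hM
      have h3 := (truncModule g d).smul_mem (one_half_pos (α := ℝ)).le <|
        normSq_mem_truncModule g (d := d)
          (p := MvPolynomial.monomial α 1 + MvPolynomial.monomial β c)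
          ((MvPolynomial.totalDegree_add _ _).trans (max_le
            ((totalDegree_monomial_le_degree α _).trans h.1)
            ((totalDegree_monomial_le_degree β _).trans h.2)))
      convert (truncModule g d).add_mem (add_mem h1 h2) h3 using 1
      ext z
      simp only [Pi.add_apply, Pi.smul_apply, reEval_apply, truncEval_single, if_pos h,
        map_add, eval_monomial_eq_mono, one_mul, Complex.real_smul]
      norm_cast
      simp only [Complex.sq_norm, Complex.normSq_apply, Complex.add_re, Complex.add_im,
        Complex.mul_re, Complex.mul_im, Complex.conj_re, Complex.conj_im]
      ring
    · refine ⟨0, ?_⟩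
      convert (truncModule g d).zero_mem using 1
      ext z
      simp [reEval_apply, truncEval_single, h]

/-! ### From functionals to moment families -/

/-- The localizing matrices of a Hermitian family are Hermitian. -/
theorem localizing_isHermitian {d e : ℕ} {φ : ConjPoly n} (hφ : IsRealValued φ)
    {y : Matrix (BddIndex n d) (BddIndex n d) ℂ} (hy : y.IsHermitian) :
    (localizing e φ y).IsHermitian := by
  have hent : ∀ α β, starRingEnd ℂ (entry y α β) = entry y β α := by
    intro α β
    unfold entry
    by_cases h : α.degree ≤ d ∧ β.degree ≤ d
    · rw [dif_pos h, dif_pos h.symm]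
      exact hy.apply _ _
    · rw [dif_neg h, dif_neg fun h' => h h'.symm, map_zero]
  refine Matrix.IsHermitian.ext fun α β => ?_
  simp only [localizing, Finsupp.sum]
  rw [← starRingEnd_apply, map_sum]
  refine Finset.sum_nbij' Prod.swap Prod.swap ?_ ?_ (fun _ _ => rfl) (fun _ _ => rfl) ?_
  · rintro ⟨γ, δ⟩ h
    simpa [hφ.apply_swap γ δ] using h
  · rintro ⟨γ, δ⟩ h
    simpa [hφ.apply_swap γ δ] using h
  · rintro ⟨γ, δ⟩ h
    simp [hent, hφ.apply_swap γ δ]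

theorem isRealValued_withOne {g : Fin m → ConjPoly n} (hg : ∀ i, IsRealValued (g i))
    (i : Fin (m + 1)) : IsRealValued (withOne g i) := by
  refine Fin.cases (fun z => ?_) (fun i => ?_) i
  · simp [withOne, evalAt_onePoly]
  · simpa only [withOne, Fin.cons_succ] using hg i

/-- A normalised functional that is nonnegative on the truncated quadratic module comes from a
feasible moment family. -/
theorem exists_momentFeasible_of_functional {g : Fin m → ConjPoly n}
    (hg : ∀ i, IsRealValued (g i)) {d : ℕ} (hd : ∀ i, order (withOne g i) ≤ d)
    {L : ConjPoly n →ₗ[ℝ] ℝ} (hL1 : L (onePoly n) = 1)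
    (hL : ∀ φ ∈ (truncModule g d).comap (reEval n d), 0 ≤ L φ) :
    ∃ y ∈ momentFeasible g d, ∀ φ, (riesz y φ).re = L φ := by
  -- Such `φ` and `-φ` both lie in the cone, so `L` sees only the truncated real part.
  have hker : ∀ φ, (∀ z, (truncEval d z φ).re = 0) → L φ = 0 := by
    intro φ hφ
    have h0 : reEval n d φ = 0 := by
      ext z
      simp [reEval_apply, hφ z]
    have h1 := hL φ (by rw [PointedCone.mem_comap, h0]; exact zero_mem _)
    have h2 := hL (-φ) (by rw [PointedCone.mem_comap, map_neg, h0, neg_zero]; exact zero_mem _)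
    rw [map_neg] at h2
    linarith
  -- The complex-linear functional with real part `L`; its values on monomials are the moments.
  let Lc : ConjPoly n →ₗ[ℂ] ℂ := Module.Dual.extendRCLike (𝕜 := ℂ) L
  have hre : ∀ φ, (Lc φ).re = L φ := fun φ => by
    simp [Lc, Module.Dual.extendRCLike_apply]
  have him : ∀ φ, (Lc φ).im = -L (Complex.I • φ) := fun φ => by
    simp [Lc, Module.Dual.extendRCLike_apply]
  let y : Matrix (BddIndex n d) (BddIndex n d) ℂ :=
    fun α β => Lc (Finsupp.single (α.1, β.1) 1)
  have hentry : ∀ α β, entry y α β = Lc (Finsupp.single (α, β) 1) := by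
    intro α β
    unfold entry
    split_ifs with h
    · rfl
    -- Out-of-range monomials are killed, in agreement with the default value `0` of `entry`.
    · have h0 : ∀ c : ℂ, L (c • Finsupp.single (α, β) 1) = 0 := fun c =>
        hker _ fun z => by rw [map_smul, truncEval_single, if_neg h]; simp
      apply Complex.ext
      · rw [hre, ← one_smul ℂ (Finsupp.single (α, β) (1 : ℂ)), h0]; rfl
      · rw [him, h0]; simp
  have hriesz : ∀ φ, riesz y φ = Lc φ := by
    intro φ
    rw [← rieszLin_apply]
    congr 1
    refine Finsupp.lhom_ext fun ab c => ?_
    rw [rieszLin, Finsupp.linearCombination_single, hentry, ← map_smul, Finsupp.smul_single,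
      smul_eq_mul, mul_one]
  have hherm : y.IsHermitian := by
    refine Matrix.IsHermitian.ext fun α β => ?_
    -- The two polynomials are complex conjugates, so their real parts agree.
    have hsub : ∀ c : ℂ, L (c • Finsupp.single (β.1, α.1) 1) =
        L (starRingEnd ℂ c • Finsupp.single (α.1, β.1) 1) := by
      intro c
      rw [← sub_eq_zero, ← map_sub]
      refine hker _ fun z => ?_
      rw [map_sub, map_smul, map_smul, truncEval_single, truncEval_single, if_pos ⟨β.2, α.2⟩,
        if_pos ⟨α.2, β.2⟩]
      simp
      ring
    change starRingEnd ℂ (Lc _) = Lc _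
    apply Complex.ext
    · rw [Complex.conj_re, hre, hre]
      simpa using hsub 1
    · rw [Complex.conj_im, him, him, hsub]
      simp
  have hone : riesz y (onePoly n) = 1 := by
    apply Complex.ext
    · rw [hriesz, hre, hL1]; rfl
    · rw [hriesz, him, hker _ fun z => ?_]
      · simp
      · rw [map_smul, truncEval_eq_evalAt (by simp [order_onePoly]), evalAt_onePoly]
        simp
  refine ⟨y, ⟨hherm, ?_, fun i => ⟨localizing_isHermitian ?_ hherm, fun x => ?_⟩⟩,
    fun φ => by rw [hriesz, hre]⟩
  · rw [← hone, ← rieszLin_apply, rieszLin, onePoly, Finsupp.linearCombination_single, one_smul]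
  · exact isRealValued_withOne hg i
  · have hreal := isRealValued_withOne hg i
    have hev := truncEval_gram x (φ := withOne g i) (d := d) (by have := hd i; omega)
    rw [← rieszLin_gram, rieszLin_apply, hriesz, Complex.nonneg_iff, hre, him]
    constructor
    · apply hL
      obtain ⟨p, hp, hpx⟩ := exists_poly_eq_holo x
      rw [PointedCone.mem_comap]
      convert normSq_mul_mem_truncModule g i hp using 1
      ext z
      rw [reEval_apply, hev, hpx, Complex.re_ofReal_mul, Complex.ofReal_mul,
        Complex.conj_eq_iff_re.1 (hreal z)]
    -- The imaginary part is `-L(i|p|²g_i)`, and `i|p|²g_i` has zero real part because `g_i` is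
    -- real-valued.
    · rw [hker, neg_zero]
      intro z
      rw [map_smul, hev, smul_eq_mul, Complex.I_mul_re, Complex.im_ofReal_mul,
        Complex.conj_eq_iff_im.1 (hreal z)]
      simp

/-! ### Weak and strong duality -/

theorem order_withOne_le {f : ConjPoly n} {g : Fin m → ConjPoly n} {d : ℕ}
    (hd : minOrder f g ≤ d) (i : Fin (m + 1)) : order (withOne g i) ≤ d := by
  refine Fin.cases ?_ (fun i => ?_) i
  · simp [withOne, order_onePoly]
  · refine le_trans ?_ ((le_max_right _ _).trans hd)
    simpa [withOne] using Finset.le_sup (f := fun i => order (g i)) (Finset.mem_univ i)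

theorem le_riesz_of_sosFeasible {f : ConjPoly n} {g : Fin m → ConjPoly n} {d : ℕ} {l : ℝ}
    (hl : l ∈ sosFeasible f g d) {y : Matrix (BddIndex n d) (BddIndex n d) ℂ}
    (hy : y ∈ momentFeasible g d) : l ≤ (riesz y f).re := by
  obtain ⟨σ, hσ, hf⟩ := hl
  obtain ⟨-, hy1, hpsd⟩ := hy
  choose r p _ hp hσ using hσ
  choose x hx using fun i j => exists_holo_eq_poly (p i j) (hp i j)
  have hid : f = (l : ℂ) • onePoly n + ∑ i, ∑ j, gram (x i j) (withOne g i) := by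
    refine eq_of_evalLin_eq fun z => ?_
    simp only [map_add, map_smul, map_sum, evalLin_gram, ← Finset.sum_mul]
    rw [evalLin_apply, evalLin_apply, evalAt_onePoly]
    rw [← sub_eq_iff_eq_add', smul_eq_mul, mul_one, hf z]
    refine Finset.sum_congr rfl fun i _ => ?_
    simp only [hσ, hx, Complex.ofReal_sum]
  have hone : rieszLin y (onePoly n) = 1 := by
    rw [rieszLin, onePoly, Finsupp.linearCombination_single, one_smul, hy1]
  rw [← rieszLin_apply, hid, map_add, map_smul, hone, map_sum, Complex.add_re, Complex.re_sum]
  have : 0 ≤ ∑ i, (rieszLin y (∑ j, gram (x i j) (withOne g i))).re := by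
    refine Finset.sum_nonneg fun i _ => ?_
    rw [map_sum, Complex.re_sum]
    refine Finset.sum_nonneg fun j _ => ?_
    rw [rieszLin_gram]
    exact (Complex.nonneg_iff.1 ((hpsd i).2 (x i j))).1
  simpa using this

theorem mem_sosFeasible_of_mem {f : ConjPoly n} {g : Fin m → ConjPoly n} (hf : IsRealValued f)
    {d : ℕ} (hd : order f ≤ d) {l : ℝ}
    (h : (-l) • onePoly n + f ∈ (truncModule g d).comap (reEval n d)) :
    l ∈ sosFeasible f g d := by
  obtain ⟨σ, hσ, h⟩ := PointedCone.mem_comap.1 h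
  refine ⟨σ, hσ, fun z => ?_⟩
  rw [← h z, map_add, map_smul, reEval_one, Pi.add_apply, reEval_apply, truncEval_eq_evalAt hd,
    Complex.conj_eq_iff_re.1 (hf z)]
  simp
  ring

theorem sosFeasible_nonempty {f : ConjPoly n} {g : Fin m → ConjPoly n} (hf : IsRealValued f)
    (hg : SphereAssumption g) {d : ℕ} (hd : order f ≤ d) : (sosFeasible f g d).Nonempty := by
  obtain ⟨N, hN⟩ := exists_const_add_reEval_mem hg d f
  exact ⟨-N, mem_sosFeasible_of_mem hf hd (by rwa [neg_neg])⟩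

theorem exists_momentFeasible_of_notMem {f : ConjPoly n} {g : Fin m → ConjPoly n}
    (hf : IsRealValued f) (hg : ∀ i, IsRealValued (g i)) (hsphere : SphereAssumption g) {d : ℕ}
    (hd : minOrder f g ≤ d) {l : ℝ} (hl : l ∉ sosFeasible f g d) :
    ∃ y ∈ momentFeasible g d, (riesz y f).re ≤ l := by
  obtain ⟨L, hL1, hL, hLf⟩ := exists_functional_of_notMem
    ((truncModule g d).comap (reEval n d)) (e := onePoly n) (p := (-l) • onePoly n + f)
    (by
      rw [PointedCone.mem_comap, reEval_one]
      simpa [Pi.one_def] using const_mem_truncModule g d zero_le_one)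
    (exists_const_add_reEval_mem hsphere d)
    (fun h => hl (mem_sosFeasible_of_mem hf ((le_max_left _ _).trans hd) h))
  obtain ⟨y, hy, hyL⟩ := exists_momentFeasible_of_functional hg (order_withOne_le hd) hL1 hL
  refine ⟨y, hy, ?_⟩
  rw [hyL]
  simp only [map_add, map_smul, hL1, smul_eq_mul, mul_one] at hLf
  linarith

theorem sosValue_le_momentValue (f : ConjPoly n) (g : Fin m → ConjPoly n) (d : ℕ) :
    sosValue f g d ≤ momentValue f g d :=
  iSup₂_le fun _ hl => le_iInf₂ fun _ hy => EReal.coe_le_coe_iff.2 (le_riesz_of_sosFeasible hl hy)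

end ComplexHierarchy

end

theorem mainTheorem4 {n m : ℕ} (hn : 0 < n)
    (f : ComplexHierarchy.ConjPoly n) (g : Fin m → ComplexHierarchy.ConjPoly n)
    (hf : ComplexHierarchy.IsRealValued f) (hg : ∀ i, ComplexHierarchy.IsRealValued (g i))
    (hsphere : ComplexHierarchy.SphereAssumption g)
    (d : ℕ) (hd : ComplexHierarchy.minOrder f g ≤ d) :
    ComplexHierarchy.sosValue f g d = ComplexHierarchy.momentValue f g d ∧
      ComplexHierarchy.momentValue f g d ≠ ⊥ := by
  have hweak := ComplexHierarchy.sosValue_le_momentValue f g d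
  obtain ⟨l₀, hl₀⟩ :=
    ComplexHierarchy.sosFeasible_nonempty hf hsphere ((le_max_left _ _).trans hd)
  have hbot : (l₀ : EReal) ≤ ComplexHierarchy.sosValue f g d :=
    le_iSup₂ (f := fun (l : ℝ) (_ : l ∈ ComplexHierarchy.sosFeasible f g d) => (l : EReal)) l₀ hl₀
  -- It suffices to bound `ρ_d` by every real `l > ρ*_d`; this is vacuous when `ρ*_d = +∞`.
  refine ⟨hweak.antisymm (EReal.le_of_forall_lt_iff_le.1 fun l hl => ?_),
    ((EReal.bot_lt_coe l₀).trans_le (hbot.trans hweak)).ne'⟩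
  have hnot : l ∉ ComplexHierarchy.sosFeasible f g d := fun h => hl.not_ge <|
    le_iSup₂ (f := fun (l : ℝ) (_ : l ∈ ComplexHierarchy.sosFeasible f g d) => (l : EReal)) l h
  obtain ⟨y, hy, hyl⟩ :=
    ComplexHierarchy.exists_momentFeasible_of_notMem hf hg hsphere hd hnot
  exact (iInf₂_le y hy).trans (EReal.coe_le_coe_iff.2 hyl)
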